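/- Let $k$ be a field, let $\Lambda$ be a finite-dimensional $k$-algebra, let $\Lambda\text{-mod}$ be the category of finitely generated (left) $\Lambda$-modules, and let $D^b(\Lambda)$ be its bounded derived category. Complexes are graded homologically. Let $$L\to M\to N\to L[1]$$ be an Auslander–Reiten triangle in $D^b(\Lambda)$, that is, a distinguished triangle in which $L$ and $N$ are indecomposable, the map $N\to L[1]$ is nonzero, and every morphism $W\to N$ in $D^b(\Lambda)$ that is not a split epimorphism factors through $M\to N$. Suppose that $N$ is isomorphic in $D^b(\Lambda)$ to a truncated projective resolution of some non-projective module $X$ in $\Lambda\text{-mod}$: there are a projective resolution $\cdots\to P_2\to P_1\to P_0\to X\to 0$ in $\Lambda\text{-mod}$ and an integer $n\ge 1$ such that $N$ is isomorphic to the complex $P_n\to\cdots\to P_1\to P_0$ with $P_i$ in degree $i$. Then $$0\to H_0(L)\to H_0(M)\to H_0(N)\to 0$$ is a short exact sequence of $\Lambda$-modules, and it is isomorphic either to a split short exact sequence, or to the direct sum of a split short exact sequence and an Auslander–Reiten sequence in $\Lambda\text{-mod}$. Here an Auslander–Reiten sequence is a short exact sequence $0\to A\xrightarrow{f}B\xrightarrow{g}C\to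 0$ in $\Lambda\text{-mod}$ such that $f$ is left almost split ($f$ is not a split monomorphism, and every morphism $A\to U$ in $\Lambda\text{-mod}$ that is not a split monomorphism factors through $f$) and $g$ is right almost split ($g$ is not a split epimorphism, and every morphism $U\to C$ in $\Lambda\text{-mod}$ that is not a split epimorphism factors through $g$). -/

import Mathlib

open CategoryTheory Limits Pretriangulated

universe w v u u₁

namespace ARTheory

section AlmostSplit

variable {C : Type u} [Category.{v} C]

/-- A morphism `g : B ⟶ X` is right almost split if it is not a split epimorphism and every
morphism into `X` that is not a split epimorphism factors through `g`. -/
def IsRightAlmostSplit {B X : C} (g : B ⟶ X) : Prop :=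
  ¬ IsSplitEpi g ∧ ∀ ⦃U : C⦄ (h : U ⟶ X), ¬ IsSplitEpi h → ∃ h' : U ⟶ B, h' ≫ g = h

/-- A morphism `f : A ⟶ B` is left almost split if it is not a split monomorphism and every
morphism out of `A` that is not a split monomorphism factors through `f`. -/
def IsLeftAlmostSplit {A B : C} (f : A ⟶ B) : Prop :=
  ¬ IsSplitMono f ∧ ∀ ⦃U : C⦄ (h : A ⟶ U), ¬ IsSplitMono h → ∃ h' : B ⟶ U, f ≫ h' = h

/-- An Auslander-Reiten (almost split) sequence in an abelian category: a short exact sequence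
`0 ⟶ X₁ ⟶ X₂ ⟶ X₃ ⟶ 0` whose first map is left almost split and whose second map is right
almost split. -/
structure IsARSequence [Abelian C] (S : ShortComplex C) : Prop where
  shortExact : S.ShortExact
  left_almost_split : IsLeftAlmostSplit S.f
  right_almost_split : IsRightAlmostSplit S.g

end AlmostSplit

/-- An Auslander-Reiten triangle `X₁ ⟶ X₂ ⟶ X₃ ⟶ X₁⟦1⟧` in a triangulated category (Happel's
axioms): a distinguished triangle with indecomposable end terms and nonzero third map, such that
every morphism into `X₃` that is not a split epimorphism factors through `X₂ ⟶ X₃`. -/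
structure IsARTriangle {C : Type u} [Category.{v} C] [Preadditive C] [HasZeroObject C]
    [HasShift C ℤ] [∀ n : ℤ, (shiftFunctor C n).Additive] [Pretriangulated C]
    [HasBinaryBiproducts C] (T : Triangle C) : Prop where
  distinguished : T ∈ distTriang C
  indecomposable₁ : Indecomposable T.obj₁
  indecomposable₃ : Indecomposable T.obj₃
  mor₃_ne_zero : T.mor₃ ≠ 0
  exists_lift : ∀ ⦃W : C⦄ (f : W ⟶ T.obj₃), ¬ IsSplitEpi f → ∃ f' : W ⟶ T.obj₂, f' ≫ T.mor₂ = f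

section Derived

variable {C : Type u} [Category.{v} C] [Abelian C] [HasDerivedCategory.{w} C]

/-- `N`, as an object of the derived category, is a truncated projective resolution
`P_n ⟶ ⋯ ⟶ P_1 ⟶ P_0` of `X`, where `n ≥ 1` and `⋯ ⟶ P_1 ⟶ P_0` is a projective resolution
of `X`. The homological degree `i` is the cohomological degree `-i`. (For `n = 0` the truncation
would be the stalk complex of a projective object and would not determine `X`.) -/
def IsTruncatedProjectiveResolution (N : DerivedCategory C) (X : C) : Prop :=
  ∃ (P : ProjectiveResolution X) (n : ℕ), 1 ≤ n ∧
    Nonempty (N ≅ DerivedCategory.Q.obj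
      (P.cochainComplex.stupidTrunc (ComplexShape.embeddingUpIntGE (-(n : ℤ)))))

variable (C) in
/-- The homology functor `H_0 : D^b(C) ⥤ C`. -/
noncomputable abbrev boundedH₀ : DerivedCategory.Bounded C ⥤ C :=
  DerivedCategory.Bounded.ι ⋙ DerivedCategory.homologyFunctor C 0

/-- The sequence `H_0(L) ⟶ H_0(M) ⟶ H_0(N)` attached to a distinguished triangle
`L ⟶ M ⟶ N ⟶ L⟦1⟧` in `D^b(C)`. -/
noncomputable def h₀Sequence (T : Triangle (DerivedCategory.Bounded C))
    (hT : T ∈ distTriang (DerivedCategory.Bounded C)) : ShortComplex C :=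
  (shortComplexOfDistTriangle T hT).map (boundedH₀ C)

end Derived

/-- The category `Λ`-mod of finitely generated (equivalently, finite-dimensional) left modules
over a finite-dimensional `k`-algebra `Λ`. The field is a parameter only so that `Λ` is seen to be
Noetherian. -/
def FDMod (k : Type u₁) (Λ : Type u) [Field k] [Ring Λ] [Algebra k Λ] [FiniteDimensional k Λ] :
    Type (u + 1) :=
  FGModuleCat.{u} Λ

section FDMod

variable (k : Type u₁) (Λ : Type u) [Field k] [Ring Λ] [Algebra k Λ] [FiniteDimensional k Λ]

noncomputable instance : Category.{u} (FDMod k Λ) :=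
  inferInstanceAs (Category.{u} (FGModuleCat.{u} Λ))

noncomputable instance : Abelian (FDMod k Λ) :=
  haveI : IsNoetherianRing Λ := IsNoetherianRing.of_finite k Λ
  inferInstanceAs (Abelian (FGModuleCat.{u} Λ))

end FDMod

end ARTheory

/-! The resolution gives `a : N ⟶ X`, with `X` in degree zero, an isomorphism on `H₀`; let `u : Y ⟶
N` be its fibre, so `H₀(Y) = 0`. Pulling `a` back along a morphism `U ⟶ X` realises it as `H₀` of
some `W ⟶ N` (`exists_lift_single`). If it is not a split epimorphism, neither is `W ⟶ N`, which
then factors through `M`; so every non-split-epi into `H₀(N)` factors through `H₀(M)`. Applied to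
`P₀ ⟶ X`, this makes `H₀(M) ⟶ H₀(N)` epi. Also `u` factors through `M` and is epi on `H₁`, so `H₁(M)
⟶ H₁(N)` is epi and `H₀(L) ⟶ H₀(M)` is mono. If the epimorphism does not split, it is right almost
split. Fitting's lemma splits off a summand of `H₀(M)` leaving a right minimal map, whose kernel
inclusion is then left almost split. -/

namespace ARTheory

/-! ### Right minimal, right almost split epimorphisms -/

section Abelian

open scoped ZeroObject

variable {C : Type u} [Category.{v} C] [Abelian C]

/-- A right minimal morphism: every endomorphism of the source over the target is invertible. -/
def IsRightMinimal {B X : C} (g : B ⟶ X) : Prop :=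
  ∀ φ : B ⟶ B, φ ≫ g = g → IsIso φ

/-- Push the sequence out along `u`. If the new sequence splits, `u` extends along `S.f`. Otherwise
its epimorphism lifts through `S.g`, giving an endomorphism of `S.X₂` over `S.X₃`; minimality makes
it invertible, and restricting to `S.X₁` exhibits a retraction of `u`. -/
lemma isARSequence_of_isRightMinimal {S : ShortComplex C} (hS : S.ShortExact)
    (hg : IsRightAlmostSplit S.g) (hmin : IsRightMinimal S.g) : IsARSequence S where
  shortExact := hS
  right_almost_split := hg
  left_almost_split := by
    have := hS.mono_f
    have := hS.epi_g
    refine ⟨fun h ↦ hg.1 ?_, fun U u hu ↦ ?_⟩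
    · exact (ShortComplex.Splitting.ofExactOfRetraction S hS.exact (retraction S.f)
          (IsSplitMono.id S.f) hS.epi_g).isSplitEpi_g
    · have hsq := IsPushout.of_hasPushout S.f u
      set j := pushout.inl S.f u
      set i := pushout.inr S.f u
      obtain ⟨q, hjq, hiq⟩ : ∃ q, j ≫ q = S.g ∧ i ≫ q = 0 :=
        ⟨pushout.desc S.g 0 (by simp), pushout.inl_desc _ _ _, pushout.inr_desc _ _ _⟩
      by_cases hq : IsSplitEpi q
      · have : Epi q := inferInstance
        have hS' : (ShortComplex.mk i q hiq).ShortExact :=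
          { exact := ShortComplex.exact_of_g_is_cokernel _
              (CokernelCofork.IsColimit.ofπ' _ _ fun {A} k hk ↦ by
                have hjk : S.f ≫ j ≫ k = 0 := by
                  rw [← Category.assoc, hsq.w, Category.assoc]; simp [hk]
                refine ⟨hS.exact.desc _ hjk, ?_⟩
                apply hsq.hom_ext
                · rw [reassoc_of% hjq, hS.exact.g_desc]
                · rw [reassoc_of% hiq, zero_comp]; exact hk.symm)
            mono_f := by dsimp; exact inferInstanceAs (Mono (pushout.inr S.f u))
            epi_g := this }
        let σ := ShortComplex.Splitting.ofExactOfSection _ hS'.exact (section_ q)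
          (IsSplitEpi.id q) hS'.mono_f
        refine ⟨j ≫ σ.r, ?_⟩
        rw [reassoc_of% hsq.w, show i ≫ σ.r = 𝟙 U from σ.f_r, Category.comp_id]
      · obtain ⟨t, ht⟩ := hg.2 q hq
        have := hmin (j ≫ t) (by rw [Category.assoc, ht, hjq])
        refine absurd ?_ hu
        have hit : (i ≫ t) ≫ S.g = 0 := by rw [Category.assoc, ht, hiq]
        let ψ : U ⟶ S.X₁ := hS.exact.lift (i ≫ t) hit
        have hψ : ψ ≫ S.f = i ≫ t := hS.exact.lift_f _ _
        have hφ : (u ≫ ψ) ≫ S.f = S.f ≫ j ≫ t := by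
          rw [Category.assoc, hψ, ← reassoc_of% hsq.w]
        have hinv : (S.f ≫ inv (j ≫ t)) ≫ S.g = 0 := by
          have : inv (j ≫ t) ≫ S.g = S.g := by rw [IsIso.inv_comp_eq, Category.assoc, ht, hjq]
          rw [Category.assoc, this, S.zero]
        let χ : S.X₁ ⟶ S.X₁ := hS.exact.lift _ hinv
        have hχ : χ ≫ S.f = S.f ≫ inv (j ≫ t) := hS.exact.lift_f _ _
        refine IsSplitMono.mk' ⟨ψ ≫ χ, ?_⟩
        rw [← cancel_mono S.f, Category.assoc, Category.assoc, hχ, ← Category.assoc, ← Category.assoc,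
          hφ, Category.assoc, IsIso.hom_inv_id, Category.comp_id, Category.id_comp]

/-- A short exact sequence whose epimorphism is right almost split and factors through a retract
on which it is right minimal is the sum of a split sequence and an Auslander-Reiten sequence. -/
lemma exists_splitting_and_isARSequence {S : ShortComplex C} (hS : S.ShortExact)
    (hg : IsRightAlmostSplit S.g) {B' : C} (i : B' ⟶ S.X₂) (p : S.X₂ ⟶ B') (hip : i ≫ p = 𝟙 B')
    (hpi : p ≫ i ≫ S.g = S.g) (hmin : IsRightMinimal (i ≫ S.g)) :
    ∃ S₁ S₂ : ShortComplex C, Nonempty S₁.Splitting ∧ IsARSequence S₂ ∧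
      Nonempty (S ≅ S₁ ⊞ S₂) := by
  have := hS.mono_f
  have := hS.epi_g
  let S₂ : ShortComplex C := ShortComplex.mk (kernel.ι (i ≫ S.g)) (i ≫ S.g) (kernel.condition _)
  -- `p ≫ i ≫ S.g = S.g` puts `kernel p` inside the kernel of `S.g`, so it splits off from both
  -- `S.X₁` and `S.X₂`.
  let S₁ : ShortComplex C := ShortComplex.mk (𝟙 (kernel p)) (0 : kernel p ⟶ 0) comp_zero
  have hκ : kernel.ι p ≫ S.g = 0 := by rw [← hpi, kernel.condition_assoc, zero_comp]
  let ρ : S.X₂ ⟶ kernel p := kernel.lift p (𝟙 _ - p ≫ i) (by simp [hip])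
  have hρ : ρ ≫ kernel.ι p = 𝟙 _ - p ≫ i := kernel.lift_ι _ _ _
  have hepi : Epi (i ≫ S.g) := by
    have : Epi (p ≫ i ≫ S.g) := by rw [hpi]; infer_instance
    exact epi_of_epi p _
  let in₁ : S₁ ⟶ S :=
    { τ₁ := hS.exact.lift (kernel.ι p) hκ
      τ₂ := kernel.ι p
      τ₃ := 0
      comm₁₂ := by simp [S₁]
      comm₂₃ := by simp [S₁, hκ] }
  let in₂ : S₂ ⟶ S :=
    { τ₁ := hS.exact.lift (kernel.ι (i ≫ S.g) ≫ i) (by simp)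
      τ₂ := i
      τ₃ := 𝟙 _
      comm₁₂ := by simp [S₂]
      comm₂₃ := by simp [S₂] }
  let pr₁ : S ⟶ S₁ :=
    { τ₁ := S.f ≫ ρ
      τ₂ := ρ
      τ₃ := 0
      comm₁₂ := by simp [S₁]
      comm₂₃ := by simp [S₁] }
  let pr₂ : S ⟶ S₂ :=
    { τ₁ := kernel.lift _ (S.f ≫ p) (by simp [hpi])
      τ₂ := p
      τ₃ := 𝟙 _
      comm₁₂ := by simp [S₂]
      comm₂₃ := by simp [S₂, hpi] }
  have hin₁ : in₁.τ₁ ≫ S.f = kernel.ι p := hS.exact.lift_f _ _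
  have hin₂ : in₂.τ₁ ≫ S.f = kernel.ι (i ≫ S.g) ≫ i := hS.exact.lift_f _ _
  have hpr₂ : pr₂.τ₁ ≫ kernel.ι (i ≫ S.g) = S.f ≫ p := kernel.lift_ι _ _ _
  have hκρ : kernel.ι p ≫ ρ = 𝟙 _ := by
    rw [← cancel_mono (kernel.ι p), Category.assoc, hρ]; simp
  have hiρ : i ≫ ρ = 0 := by
    rw [← cancel_mono (kernel.ι p), Category.assoc, hρ]; simp [reassoc_of% hip]
  let b : BinaryBicone S₁ S₂ :=
    { pt := S
      fst := pr₁
      snd := pr₂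
      inl := in₁
      inr := in₂
      inl_fst := by
        refine ShortComplex.hom_ext _ _ ?_ ?_ ?_
        · change in₁.τ₁ ≫ S.f ≫ ρ = 𝟙 (kernel p)
          rw [reassoc_of% hin₁, hκρ]
        · exact hκρ
        · exact (isZero_zero C).eq_of_src _ _
      inl_snd := by
        refine ShortComplex.hom_ext _ _ ?_ ?_ ?_
        · rw [← cancel_mono (kernel.ι (i ≫ S.g))]
          change (in₁.τ₁ ≫ pr₂.τ₁) ≫ _ = 0 ≫ _
          rw [Category.assoc, hpr₂, reassoc_of% hin₁, kernel.condition, zero_comp]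
        · exact kernel.condition p
        · exact (isZero_zero C).eq_of_src _ _
      inr_fst := by
        refine ShortComplex.hom_ext _ _ ?_ ?_ ?_
        · change in₂.τ₁ ≫ S.f ≫ ρ = 0
          rw [reassoc_of% hin₂, hiρ, comp_zero]
        · exact hiρ
        · exact (isZero_zero C).eq_of_tgt _ _
      inr_snd := by
        refine ShortComplex.hom_ext _ _ ?_ ?_ ?_
        · rw [← cancel_mono (kernel.ι (i ≫ S.g))]
          change (in₂.τ₁ ≫ pr₂.τ₁) ≫ _ = 𝟙 _ ≫ _
          rw [Category.assoc, hpr₂, reassoc_of% hin₂, hip, Category.comp_id, Category.id_comp]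
        · exact hip
        · exact Category.id_comp _ }
  have hb : b.IsBilimit := isBinaryBilimitOfTotal b (by
    refine ShortComplex.hom_ext _ _ ?_ ?_ ?_
    · rw [← cancel_mono S.f]
      change ((S.f ≫ ρ) ≫ in₁.τ₁ + pr₂.τ₁ ≫ in₂.τ₁) ≫ S.f = 𝟙 _ ≫ S.f
      rw [Preadditive.add_comp, Category.assoc, Category.assoc, hin₁, Category.assoc, hin₂,
        reassoc_of% hpr₂, hρ]
      simp
    · change ρ ≫ kernel.ι p + p ≫ i = 𝟙 _
      rw [hρ]; simp
    · change (0 : S.X₃ ⟶ 0) ≫ 0 + 𝟙 _ ≫ 𝟙 _ = 𝟙 _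
      simp)
  refine ⟨S₁, S₂, ⟨⟨𝟙 _, 0, ?_, ?_, ?_⟩⟩, ?_, ⟨biprod.uniqueUpToIso S₁ S₂ hb⟩⟩
  · simp [S₁]
  · exact (isZero_zero C).eq_of_src _ _
  · simp [S₁]
  · refine isARSequence_of_isRightMinimal (S := S₂) ⟨?_⟩ ⟨fun h ↦ hg.1 ?_, fun U h hh ↦ ?_⟩ hmin
    · exact ShortComplex.exact_kernel _
    · exact IsSplitEpi.mk' ⟨section_ (i ≫ S.g) ≫ i, by
        rw [Category.assoc]; exact IsSplitEpi.id (i ≫ S.g)⟩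
    · obtain ⟨h', hh'⟩ := hg.2 h hh
      exact ⟨h' ≫ p, by change (h' ≫ p) ≫ i ≫ S.g = h; rw [Category.assoc, hpi, hh']⟩

end Abelian

/-! ### Zeroth homology of a truncated resolution -/

section StupidTruncation

variable {C : Type u} [Category.{v} C] [Abelian C]

lemma stupidTruncXIso_hom_comp_d {ι ι' : Type*} {c : ComplexShape ι} {c' : ComplexShape ι'}
    (K : HomologicalComplex C c') (e : c.Embedding c') [e.IsRelIff] {i j : ι} {i' j' : ι'}
    (hi : e.f i = i') (hj : e.f j = j') :
    (K.stupidTruncXIso e hi).hom ≫ K.d i' j' =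
      (K.stupidTrunc e).d i' j' ≫ (K.stupidTruncXIso e hj).hom := by
  subst hi hj
  change (((K.restriction e).extendXIso e rfl).hom ≫ 𝟙 ((K.restriction e).X i)) ≫
      (K.restriction e).d i j =
    ((K.restriction e).extend e).d (e.f i) (e.f j) ≫
      ((K.restriction e).extendXIso e rfl).hom ≫ 𝟙 ((K.restriction e).X j)
  rw [(K.restriction e).extend_d_eq e rfl rfl, Category.comp_id, Category.comp_id, Category.assoc,
    Category.assoc, Iso.inv_hom_id, Category.comp_id]

lemma exists_quasiIsoAt_zero_stupidTrunc {X : C} (P : ProjectiveResolution X) (n : ℕ) (hn : 1 ≤ n) :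
    ∃ a : P.cochainComplex.stupidTrunc (ComplexShape.embeddingUpIntGE (-(n : ℤ))) ⟶
      (CochainComplex.singleFunctor C 0).obj X, QuasiIsoAt a 0 := by
  let K := P.cochainComplex
  let e := ComplexShape.embeddingUpIntGE (-(n : ℤ))
  have he₀ : e.f n = 0 := by change -(n : ℤ) + n = 0; lia
  -- Here `1 ≤ n` is needed: degrees `-1, 0, 1`, which determine `H₀`, then all survive truncation.
  have he₁ : e.f (n - 1) = -1 := by change -(n : ℤ) + (n - 1 : ℕ) = -1; lia
  have he₂ : e.f (n + 1) = 1 := by change -(n : ℤ) + (n + 1 : ℕ) = 1; lia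
  let α : (K.stupidTrunc e).sc' (-1) 0 1 ≅ K.sc' (-1) 0 1 :=
    ShortComplex.isoMk (K.stupidTruncXIso e he₁) (K.stupidTruncXIso e he₀)
      (K.stupidTruncXIso e he₂) (stupidTruncXIso_hom_comp_d K e he₁ he₀)
      (stupidTruncXIso_hom_comp_d K e he₀ he₂)
  let L := (CochainComplex.singleFunctor C 0).obj X
  have hL (i : ℤ) (hi : i ≠ 0) : IsZero (L.X i) :=
    HomologicalComplex.isZero_single_obj_X (ComplexShape.up ℤ) 0 X i hi
  let σ : L.X 0 ≅ X := HomologicalComplex.singleObjXSelf (ComplexShape.up ℤ) 0 X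
  let φ : K.X 0 ⟶ X := P.π'.f 0 ≫ σ.hom
  have hφ : K.d (-1) 0 ≫ φ = 0 := by
    change P.cochainComplex.d (-1) 0 ≫ P.π'.f 0 ≫ σ.hom = 0
    rw [← P.π'.comm_assoc, (hL (-1) (by simp)).eq_of_tgt (P.π'.f (-1)) 0, zero_comp]
  have hφσ : φ ≫ σ.inv = P.π'.f 0 := by rw [Category.assoc, σ.hom_inv_id, Category.comp_id]
  let a : K.stupidTrunc e ⟶ L :=
    HomologicalComplex.mkHomToSingle ((K.stupidTruncXIso e he₀).hom ≫ φ) (by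
      rintro i hi
      obtain rfl : i = -1 := by have : i + 1 = 0 := hi; lia
      rw [← Category.assoc, ← stupidTruncXIso_hom_comp_d K e he₁ he₀, Category.assoc, hφ,
        comp_zero])
  have ha₀ : a.f 0 = (K.stupidTruncXIso e he₀).hom ≫ P.π'.f 0 := by
    rw [← hφσ, ← Category.assoc]
    exact HomologicalComplex.mkHomToSingle_f _ _
  refine ⟨a, ?_⟩
  have hπ : QuasiIsoAt P.π' 0 := inferInstance
  rw [quasiIsoAt_iff' _ (-1) 0 1 (by simp) (by simp)] at hπ ⊢
  have ha : (HomologicalComplex.shortComplexFunctor' C _ (-1) 0 1).map a =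
      α.hom ≫ (HomologicalComplex.shortComplexFunctor' C _ (-1) 0 1).map P.π' := by
    refine ShortComplex.hom_ext _ _ ?_ ?_ ?_
    · exact (hL (-1) (by simp)).eq_of_tgt _ _
    · exact ha₀
    · exact (hL 1 (by simp)).eq_of_tgt _ _
  rw [ha]
  infer_instance

end StupidTruncation

/-! ### From the Auslander–Reiten triangle to `H₀` -/

section Derived

variable {C : Type u} [Category.{v} C] [Abelian C] [HasDerivedCategory.{w} C]

lemma bounded_singleFunctor_obj (X : C) :
    (DerivedCategory.TStructure.t (C := C)).bounded ((DerivedCategory.singleFunctor C 0).obj X) :=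
  ⟨⟨0, (inferInstance : ((DerivedCategory.singleFunctor C 0).obj X).IsGE 0)⟩,
    ⟨0, (inferInstance : ((DerivedCategory.singleFunctor C 0).obj X).IsLE 0)⟩⟩

variable (C) in
/-- The inclusion of `C` into `D^b(C)` in degree zero. -/
noncomputable def boundedSingle : C ⥤ DerivedCategory.Bounded C :=
  ObjectProperty.lift _ (DerivedCategory.singleFunctor C 0) bounded_singleFunctor_obj

variable (C) in
/-- The homology functors on the bounded derived category. -/
noncomputable abbrev boundedHomology (n : ℤ) : DerivedCategory.Bounded C ⥤ C :=
  DerivedCategory.Bounded.ι ⋙ DerivedCategory.homologyFunctor C n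

variable (C) in
/-- The zeroth homology of an object placed in degree zero is the object itself. -/
noncomputable def boundedSingleCompH₀Iso : boundedSingle C ⋙ boundedH₀ C ≅ 𝟭 C :=
  DerivedCategory.singleFunctorCompHomologyFunctorIso C 0

lemma isZero_boundedHomology_boundedSingle (X : C) (n : ℤ) (hn : n < 0) :
    IsZero ((boundedHomology C n).obj ((boundedSingle C).obj X)) :=
  DerivedCategory.isZero_of_isGE ((DerivedCategory.singleFunctor C 0).obj X) 0 n hn

lemma IsTruncatedProjectiveResolution.exists_hom {N : DerivedCategory.Bounded C} {X : C}
    (h : IsTruncatedProjectiveResolution N.obj X) :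
    ∃ a : N ⟶ (boundedSingle C).obj X, IsIso ((boundedH₀ C).map a) := by
  obtain ⟨P, n, hn, ⟨e⟩⟩ := h
  obtain ⟨a, ha⟩ := exists_quasiIsoAt_zero_stupidTrunc P n hn
  refine ⟨ObjectProperty.homMk (e.hom ≫ DerivedCategory.Q.map a), ?_⟩
  change IsIso ((DerivedCategory.homologyFunctor C 0).map (e.hom ≫ DerivedCategory.Q.map a))
  have : IsIso ((DerivedCategory.homologyFunctor C 0).map (DerivedCategory.Q.map a)) := by
    refine (NatIso.isIso_map_iff (DerivedCategory.homologyFunctorFactors C 0) a).2 ?_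
    rw [quasiIsoAt_iff_isIso_homologyMap] at ha
    exact ha
  rw [Functor.map_comp]
  infer_instance

open DerivedCategory

lemma ι_mapTriangle_distinguished {T : Triangle (Bounded C)} (hT : T ∈ distTriang _) :
    Bounded.ι.mapTriangle.obj T ∈ distTriang (DerivedCategory C) :=
  Bounded.ι.map_distinguished T hT

section Fiber

variable {N Y : Bounded C} {X : C} {u : Y ⟶ N} {a : N ⟶ (boundedSingle C).obj X}
  {w : (boundedSingle C).obj X ⟶ Y⟦(1 : ℤ)⟧} (hT : Triangle.mk u a w ∈ distTriang _)

include hT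

/-- `H₀(u)` is mono because `H₁(X) = 0` (cohomological degree `-1`), and zero because `H₀(a)` is
mono. -/
lemma isZero_H₀_fiber [IsIso ((boundedH₀ C).map a)] : IsZero ((boundedH₀ C).obj Y) := by
  have hT' := ι_mapTriangle_distinguished hT
  have h₁ : Mono ((boundedH₀ C).map u) := by
    refine (HomologySequence.mono_homologyMap_mor₁_iff _ hT' (-1) 0).2 ?_
    exact (isZero_boundedHomology_boundedSingle X (-1) (by lia)).eq_of_src _ _
  have h₂ : (boundedH₀ C).map u = 0 :=
    (HomologySequence.mono_homologyMap_mor₂_iff _ hT' 0).1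
      (inferInstanceAs (Mono ((boundedH₀ C).map a)))
  exact IsZero.of_mono_eq_zero _ h₂

lemma epi_homology_neg_one_fiber : Epi ((boundedHomology C (-1)).map u) :=
  (HomologySequence.epi_homologyMap_mor₁_iff _ (ι_mapTriangle_distinguished hT) (-1)).2
    ((isZero_boundedHomology_boundedSingle X (-1) (by lia)).eq_of_tgt _ _)

end Fiber

/-- A morphism `h : U ⟶ X` lifts to a morphism into `N` from an object whose zeroth homology
is `U`, provided that `N` maps to `X` by an isomorphism on zeroth homology. -/
lemma exists_lift_single {N : Bounded C} {X U : C} (a : N ⟶ (boundedSingle C).obj X)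
    [IsIso ((boundedH₀ C).map a)] (h : U ⟶ X) :
    ∃ (W : Bounded C) (q : W ⟶ (boundedSingle C).obj U) (v : W ⟶ N),
      IsIso ((boundedH₀ C).map q) ∧ q ≫ (boundedSingle C).map h = v ≫ a := by
  obtain ⟨Y, u, w, hT⟩ := distinguished_cocone_triangle₁ a
  -- `W` is a homotopy pullback of `a` along `h`: both triangles have the same fibre `Y`.
  obtain ⟨W, f, q, hW⟩ := distinguished_cocone_triangle₂ ((boundedSingle C).map h ≫ w)
  obtain ⟨v, -, hv⟩ := complete_distinguished_triangle_morphism₂ _ _ hW hT (𝟙 _)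
    ((boundedSingle C).map h) (by
      change ((boundedSingle C).map h ≫ w) ≫ (shiftFunctor _ (1 : ℤ)).map (𝟙 Y) = _
      rw [CategoryTheory.Functor.map_id, Category.comp_id]
      rfl)
  refine ⟨W, q, v, ?_, hv⟩
  have hT' := ι_mapTriangle_distinguished hT
  have hW' := ι_mapTriangle_distinguished hW
  have : Mono ((boundedH₀ C).map q) :=
    (HomologySequence.mono_homologyMap_mor₂_iff _ hW' 0).2
      ((isZero_H₀_fiber hT).eq_of_src _ _)
  -- The connecting map for `q` is `H₀(h)` followed by that for `a`, which vanishes since `H₀(a)` is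
  -- epi.
  have hδ : HomologySequence.δ (Bounded.ι.mapTriangle.obj (Triangle.mk u a w)) 0 1 = 0 :=
    (HomologySequence.epi_homologyMap_mor₂_iff _ hT' 0 1).1
      (inferInstanceAs (Epi ((boundedH₀ C).map a)))
  have : Epi ((boundedH₀ C).map q) := by
    refine (HomologySequence.epi_homologyMap_mor₂_iff _ hW' 0 1).2 ?_
    have heq : (Bounded.ι.mapTriangle.obj (Triangle.mk f q ((boundedSingle C).map h ≫ w))).mor₃ =
        Bounded.ι.map ((boundedSingle C).map h) ≫
          (Bounded.ι.mapTriangle.obj (Triangle.mk u a w)).mor₃ := by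
      change Bounded.ι.map ((boundedSingle C).map h ≫ w) ≫
        (Bounded.ι.commShiftIso (1 : ℤ)).hom.app Y = _
      rw [Functor.map_comp, Category.assoc]
      rfl
    have := (homologyFunctor C 0).shiftMap_comp' (Bounded.ι.map ((boundedSingle C).map h))
      (Bounded.ι.mapTriangle.obj (Triangle.mk u a w)).mor₃ 0 1 (by lia)
    rw [← heq] at this
    exact this.trans ((congrArg (fun t ↦ (homologyFunctor C 0).map
      (Bounded.ι.map ((boundedSingle C).map h)) ≫ t) hδ).trans comp_zero)
  exact isIso_of_mono_of_epi _

section ARTriangle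

variable {T : Triangle (Bounded C)} (hT : IsARTriangle T) {X : C}
  (a : T.obj₃ ⟶ (boundedSingle C).obj X) [IsIso ((boundedH₀ C).map a)]

include hT a

lemma IsARTriangle.exists_lift_H₀ {U : C} (h : U ⟶ (boundedH₀ C).obj T.obj₃)
    (hh : ¬ IsSplitEpi h) :
    ∃ h' : U ⟶ (boundedH₀ C).obj T.obj₂, h' ≫ (boundedH₀ C).map T.mor₂ = h := by
  let θ := boundedSingleCompH₀Iso C
  let h₁ : U ⟶ X := h ≫ (boundedH₀ C).map a ≫ θ.hom.app X
  obtain ⟨W, q, v, hq, hqv⟩ := exists_lift_single a h₁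
  have hnat : (boundedH₀ C).map ((boundedSingle C).map h₁) =
      θ.hom.app U ≫ h ≫ (boundedH₀ C).map a := by
    rw [← cancel_mono (θ.hom.app X)]
    simpa [h₁] using θ.hom.naturality h₁
  have hH : (boundedH₀ C).map q ≫ θ.hom.app U ≫ h = (boundedH₀ C).map v := by
    rw [← cancel_mono ((boundedH₀ C).map a), ← Functor.map_comp, ← hqv, Functor.map_comp, hnat]
    simp only [Category.assoc]
  have hv : ¬ IsSplitEpi v := fun hv ↦ hh (IsSplitEpi.mk'
    ⟨(boundedH₀ C).map (section_ v) ≫ (boundedH₀ C).map q ≫ θ.hom.app U, by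
      rw [Category.assoc, Category.assoc, hH, ← Functor.map_comp, IsSplitEpi.id,
        CategoryTheory.Functor.map_id]⟩)
  obtain ⟨v', hv'⟩ := hT.exists_lift v hv
  refine ⟨θ.inv.app U ≫ inv ((boundedH₀ C).map q) ≫ (boundedH₀ C).map v', ?_⟩
  rw [Category.assoc, Category.assoc, ← Functor.map_comp, hv', ← hH, IsIso.inv_hom_id_assoc]
  exact Iso.inv_hom_id_app_assoc θ U h

lemma IsARTriangle.shortExact_h₀Sequence (hX : ¬ Projective X) (P : ProjectiveResolution X) :
    (h₀Sequence T hT.distinguished).ShortExact := by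
  let π : P.complex.X 0 ⟶ X := P.π.f 0
  have : Epi π := inferInstanceAs (Epi (P.π.f 0))
  let e : (boundedH₀ C).obj T.obj₃ ≅ X :=
    asIso ((boundedH₀ C).map a) ≪≫ (boundedSingleCompH₀Iso C).app X
  have hN : ¬ Projective ((boundedH₀ C).obj T.obj₃) := fun h ↦ hX (Projective.of_iso e h)
  have hT' := ι_mapTriangle_distinguished hT.distinguished
  refine { exact := HomologySequence.exact₂ _ hT' 0, mono_f := ?_, epi_g := ?_ }
  · obtain ⟨Y, u, w, hY⟩ := distinguished_cocone_triangle₁ a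
    -- A split epimorphism would force `H₀(N) = 0`, which is projective.
    have hu : ¬ IsSplitEpi u := fun _ ↦ hN <| IsZero.projective <|
      IsZero.of_epi ((boundedH₀ C).map u) (isZero_H₀_fiber hY)
    obtain ⟨u', hu'⟩ := hT.exists_lift u hu
    have : Epi ((boundedHomology C (-1)).map T.mor₂) := by
      have := epi_homology_neg_one_fiber hY
      rw [← hu', Functor.map_comp] at this
      exact epi_of_epi ((boundedHomology C (-1)).map u') _
    exact (HomologySequence.mono_homologyMap_mor₁_iff _ hT' (-1) 0).2
      ((HomologySequence.epi_homologyMap_mor₂_iff _ hT' (-1) 0).1 this)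
  · have hπ : ¬ IsSplitEpi (π ≫ e.inv) := fun _ ↦ hN <|
      (Retract.mk (section_ (π ≫ e.inv)) (π ≫ e.inv) (IsSplitEpi.id _)).projective
    obtain ⟨h', hh'⟩ := hT.exists_lift_H₀ a _ hπ
    have : Epi (π ≫ e.inv) := epi_comp π e.inv
    change Epi ((boundedH₀ C).map T.mor₂)
    exact epi_of_epi_fac hh'

end ARTriangle

end Derived

/-! ### Right minimal summands via Fitting's lemma -/

section Modules

/-- Take a minimal summand `W` through which `g` factors. An endomorphism `φ` of `W` over `g` has a
Fitting decomposition, and `g` still factors through the range of `φ ^ n`; minimality forces that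
range to be `W`. -/
lemma exists_projection_forall_bijective {R M N : Type*} [Ring R] [AddCommGroup M]
    [Module R M] [AddCommGroup N] [Module R N] [IsNoetherian R M] [IsArtinian R M]
    (g : M →ₗ[R] N) :
    ∃ (W : Submodule R M) (p : M →ₗ[R] W), (∀ x : W, p x = x) ∧ (∀ x, g (p x) = g x) ∧
      ∀ φ : W →ₗ[R] W, (∀ x, g (φ x) = g x) → Function.Bijective φ := by
  let A : Set (Submodule R M) :=
    {W | ∃ p : M →ₗ[R] W, (∀ x : W, p x = x) ∧ ∀ x, g (p x) = g x}
  obtain ⟨W, ⟨p, hp, hg⟩, hmin⟩ := IsArtinian.set_has_minimal A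
    ⟨⊤, LinearMap.id.codRestrict ⊤ (by simp), fun x ↦ rfl, fun x ↦ rfl⟩
  refine ⟨W, p, hp, hg, fun φ hφ ↦ ?_⟩
  obtain ⟨n, hn, hn₁⟩ := ((φ : Module.End R W).eventually_isCompl_ker_pow_range_pow.and
    (Filter.eventually_ge_atTop 1)).exists
  have hpow (m : ℕ) (x : W) : g ((φ ^ m) x) = g x := by
    induction m generalizing x with
    | zero => rfl
    | succ m ih => rw [pow_succ, Module.End.mul_apply, ih, hφ]
  let V := LinearMap.range (φ ^ n)
  let π : W →ₗ[R] V := V.projectionOnto _ hn.symm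
  -- `φ ^ n` kills `x - π x` yet preserves values of `g`, so `g` vanishes there.
  have hπ (x : W) : g (π x : W) = g x := by
    have h₁ : x - (π x : W) ∈ LinearMap.ker (φ ^ n) := by
      rw [← Submodule.projectionOnto_apply_eq_zero_iff hn.symm]
      rw [map_sub, sub_eq_zero]
      exact (Submodule.projectionOnto_apply_left hn.symm (π x)).symm
    have h₂ := hpow n (x - (π x : W))
    rw [LinearMap.mem_ker.1 h₁] at h₂
    refine (sub_eq_zero.1 ?_).symm
    simpa using h₂.symm
  let V' := V.map W.subtype
  have hV' : V' ∈ A := by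
    refine ⟨(W.subtype.comp (V.subtype.comp (π.comp p))).codRestrict V' fun x ↦
      ⟨_, (π (p x)).2, rfl⟩, ?_, fun x ↦ ?_⟩
    · rintro ⟨_, y, hy, rfl⟩
      ext
      have : p (y : M) = y := hp y
      change ((π (p (y : M)) : W) : M) = y
      rw [this]
      exact congrArg Subtype.val (Submodule.projection_apply_of_mem_left hn.symm hy)
    · change g ((π (p x) : W) : M) = g x
      rw [hπ, hg]
  have hVW : V' = W := by
    by_contra h
    exact hmin V' hV' (lt_of_le_of_ne (Submodule.map_subtype_le _ _) h)
  have hV : V = ⊤ := Submodule.map_injective_of_injective W.injective_subtype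
    (by rw [Submodule.map_top, Submodule.range_subtype]; exact hVW)
  have hsurj : Function.Surjective φ := by
    intro y
    obtain ⟨x, hx⟩ := LinearMap.range_eq_top.1 hV y
    obtain ⟨m, rfl⟩ := Nat.exists_eq_add_of_le' hn₁
    exact ⟨(φ ^ m) x, by rw [← hx, pow_succ']; rfl⟩
  exact ⟨IsNoetherian.injective_of_surjective_endomorphism φ hsurj, hsurj⟩

lemma FGModuleCat.exists_retract_isIso {R : Type u} [Ring R] [IsNoetherianRing R]
    [IsArtinianRing R] {B X : FGModuleCat.{u} R} (g : B ⟶ X) :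
    ∃ (B' : FGModuleCat.{u} R) (i : B' ⟶ B) (p : B ⟶ B'), i ≫ p = 𝟙 B' ∧ p ≫ i ≫ g = g ∧
      ∀ φ : B' ⟶ B', φ ≫ i ≫ g = i ≫ g → IsIso φ := by
  obtain ⟨W, p, hp, hg, hW⟩ := exists_projection_forall_bijective g.hom.hom
  let B' : FGModuleCat.{u} R := FGModuleCat.of R W
  let i : B' ⟶ B := ObjectProperty.homMk (ModuleCat.ofHom W.subtype)
  let p' : B ⟶ B' := ObjectProperty.homMk (ModuleCat.ofHom p)
  refine ⟨B', i, p', ?_, ?_, fun φ hφ ↦ ?_⟩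
  · ext x
    exact congrArg Subtype.val (hp x)
  · ext x
    exact hg x
  · let φ' : W →ₗ[R] W := φ.hom.hom
    have hφ' : Function.Bijective φ' := hW φ' fun x ↦
      congrArg (fun f : B' ⟶ X ↦ f.hom.hom x) hφ
    exact (LinearEquiv.ofBijective φ' hφ').toFGModuleCatIso.isIso_hom

variable (k : Type u₁) (Λ : Type u) [Field k] [Ring Λ] [Algebra k Λ] [FiniteDimensional k Λ]

lemma FDMod.exists_retract_isRightMinimal {B X : FDMod k Λ} (g : B ⟶ X) :
    ∃ (B' : FDMod k Λ) (i : B' ⟶ B) (p : B ⟶ B'), i ≫ p = 𝟙 B' ∧ p ≫ i ≫ g = g ∧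
      IsRightMinimal (i ≫ g) :=
  haveI : IsNoetherianRing Λ := IsNoetherianRing.of_finite k Λ
  haveI : IsArtinianRing Λ := IsArtinianRing.of_finite k Λ
  FGModuleCat.exists_retract_isIso (R := Λ) (B := B) (X := X) g

end Modules

end ARTheory

/-! ### The dichotomy for the `H₀` sequence -/

theorem mainTheorem10 (k : Type u₁) (Λ : Type u) [Field k] [Ring Λ] [Algebra k Λ]
    [FiniteDimensional k Λ] [HasDerivedCategory.{w} (ARTheory.FDMod k Λ)]
    (T : Triangle (DerivedCategory.Bounded (ARTheory.FDMod k Λ)))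
    (hT : ARTheory.IsARTriangle T)
    (hN : ∃ X : ARTheory.FDMod k Λ, ¬ Projective X ∧
      ARTheory.IsTruncatedProjectiveResolution T.obj₃.obj X) :
    (ARTheory.h₀Sequence T hT.distinguished).ShortExact ∧
      ∃ S₁ : ShortComplex (ARTheory.FDMod k Λ), Nonempty S₁.Splitting ∧
        (Nonempty (ARTheory.h₀Sequence T hT.distinguished ≅ S₁) ∨
          ∃ S₂ : ShortComplex (ARTheory.FDMod k Λ), ARTheory.IsARSequence S₂ ∧
            Nonempty (ARTheory.h₀Sequence T hT.distinguished ≅ S₁ ⊞ S₂)) := by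
  obtain ⟨X, hX, hres⟩ := hN
  obtain ⟨P, -⟩ := id hres
  obtain ⟨a, ha⟩ := hres.exists_hom
  have hS : (ARTheory.h₀Sequence T hT.distinguished).ShortExact :=
    hT.shortExact_h₀Sequence a hX P
  refine ⟨hS, ?_⟩
  set S := ARTheory.h₀Sequence T hT.distinguished
  by_cases hg : IsSplitEpi S.g
  · exact ⟨S, ⟨ShortComplex.Splitting.ofExactOfSection S hS.exact (section_ S.g)
      (IsSplitEpi.id S.g) hS.mono_f⟩, Or.inl ⟨Iso.refl S⟩⟩
  · have hg' : ARTheory.IsRightAlmostSplit S.g := ⟨hg, fun _ h hh ↦ hT.exists_lift_H₀ a h hh⟩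
    obtain ⟨B, i, p, hip, hpi, hmin⟩ := ARTheory.FDMod.exists_retract_isRightMinimal k Λ S.g
    obtain ⟨S₁, S₂, h₁, h₂, e⟩ :=
      ARTheory.exists_splitting_and_isARSequence hS hg' i p hip hpi hmin
    exact ⟨S₁, h₁, Or.inr ⟨S₂, h₂, e⟩⟩
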